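/- Let $f,g_1,\dots,g_p,h_1,\dots,h_q:\mathbb{R}^n\to\mathbb{R}$ be twice continuously differentiable and consider the nonlinear program $$\min f(x)\quad\text{s.t.}\quad g_i(x)\le 0\ (i=1,\dots,p),\qquad h_j(x)=0\ (j=1,\dots,q).$$ Write $L(x,\lambda,\mu)=f(x)+\sum_{i=1}^p\lambda_i g_i(x)+\sum_{j=1}^q\mu_j h_j(x)$, let $\nabla^2L$ denote the Hessian matrix of $L$ with respect to $x$, and let $I(x)=\{i: g_i(x)=0\}$. For a feasible point $x$ let $$\Lambda(x)=\{(\lambda,\mu)\in\mathbb{R}^p\times\mathbb{R}^q:\ \nabla_xL(x,\lambda,\mu)=0,\ \lambda_i\ge 0,\ \lambda_i g_i(x)=0\ (i=1,\dots,p)\}$$ be the set of Lagrange multipliers, and let $$C(x)=\{v\in\mathbb{R}^n:\ \nabla f(x)^Tv\le 0,\ \nabla g_i(x)^Tv\le 0\ (i\in I(x)),\ \nabla h_j(x)^Tv=0\ (j=1,\dots,q)\}$$ be the critical cone. Let $x^*$ be a local minimizer of the program at which the Mangasarian-Fromovitz constraint qualification holds: the vectors $\nabla h_j(x^*)$, $j=1,\dots,q$,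 are linearly independent, and there is $u\in\mathbb{R}^n$ with $\nabla g_i(x^*)^Tu<0$ for all $i\in I(x^*)$ and $\nabla h_j(x^*)^Tu=0$ for all $j$. Suppose that there are symmetric real $n\times n$ matrices $A_1,A_2,A_3$ such that - for every vertex (extreme point) $(\lambda,\mu)$ of $\Lambda(x^*)$ there are $r_1,r_2,r_3\in\mathbb{R}$ with $\nabla^2L(x^*,\lambda,\mu)=r_1A_1+r_2A_2+r_3A_3$, and - $s_1A_1+s_2A_2+s_3A_3$ is positive definite for some $s_1,s_2,s_3\in\mathbb{R}$. Then for every set $K\subseteq C(x^*)$ which is a regular cone (that is, $cv\in K$ for all $v\in K$ and $c\ge 0$, and $K\cup(-K)$ is a linear subspace of $\mathbb{R}^n$) and whose linear span has dimension at least $3$, there exists $(\lambda,\mu)\in\Lambda(x^*)$ such that $$v^T\,\nabla^2L(x^*,\lambda,\mu)\,v\ge 0\qquad\text{for all } v\in K.$$ -/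

import Mathlib

open scoped Matrix

noncomputable section

/-- The Hessian matrix of `F : ℝⁿ → ℝ` at `x`: its `(i, j)` entry is the second derivative of `F`
at `x` in the directions of the `i`-th and the `j`-th standard basis vectors. -/
def hessianMatrix {n : ℕ} (F : EuclideanSpace ℝ (Fin n) → ℝ) (x : EuclideanSpace ℝ (Fin n)) :
    Matrix (Fin n) (Fin n) ℝ :=
  Matrix.of fun i j =>
    fderiv ℝ (fderiv ℝ F) x (EuclideanSpace.single i 1) (EuclideanSpace.single j 1)

/-- The quadratic form `vᵀ B v`. -/
def quadForm {n : ℕ} (B : Matrix (Fin n) (Fin n) ℝ) (v : EuclideanSpace ℝ (Fin n)) : ℝ :=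
  v.ofLp ⬝ᵥ (B *ᵥ v.ofLp)

/-- A set of matrices is generated by `A₁, …, A_k` if each of its members is a real linear
combination of `A₁, …, A_k`. -/
def IsGeneratedBy {n k : ℕ} (𝓑 : Set (Matrix (Fin n) (Fin n) ℝ))
    (A : Fin k → Matrix (Fin n) (Fin n) ℝ) : Prop :=
  ∀ B ∈ 𝓑, ∃ r : Fin k → ℝ, B = ∑ j, r j • A j

/-- `K ⊆ ℝⁿ` is a cone if `c • x ∈ K` for all `x ∈ K` and all `c ≥ 0`. -/
def IsCone {n : ℕ} (K : Set (EuclideanSpace ℝ (Fin n))) : Prop :=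
  ∀ x ∈ K, ∀ c : ℝ, 0 ≤ c → c • x ∈ K

/-- A cone `K` is regular if `K ∪ -K` is a linear subspace. -/
def IsRegularCone {n : ℕ} (K : Set (EuclideanSpace ℝ (Fin n))) : Prop :=
  IsCone K ∧
    ∃ S : Submodule ℝ (EuclideanSpace ℝ (Fin n)), K ∪ {x | -x ∈ K} = (S : Set _)

/-- The dimension of a subset of `ℝⁿ` is the dimension of its linear span. -/
def dimOf {n : ℕ} (K : Set (EuclideanSpace ℝ (Fin n))) : ℕ :=
  Module.finrank ℝ (Submodule.span ℝ K)

/-- The data of a nonlinear program in `ℝⁿ`: minimize `f x` subject to `g i x ≤ 0` for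
`i = 1, …, p` and `h j x = 0` for `j = 1, …, q`. -/
structure NLP (n p q : ℕ) where
  /-- the objective function -/
  f : EuclideanSpace ℝ (Fin n) → ℝ
  /-- the inequality constraints -/
  g : Fin p → EuclideanSpace ℝ (Fin n) → ℝ
  /-- the equality constraints -/
  h : Fin q → EuclideanSpace ℝ (Fin n) → ℝ

namespace NLP

variable {n p q : ℕ}

/-- All functions of the program are twice continuously differentiable. -/
def IsC2 (P : NLP n p q) : Prop :=
  ContDiff ℝ 2 P.f ∧ (∀ i, ContDiff ℝ 2 (P.g i)) ∧ ∀ j, ContDiff ℝ 2 (P.h j)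

/-- The set of feasible points. -/
def feasibleSet (P : NLP n p q) : Set (EuclideanSpace ℝ (Fin n)) :=
  {x | (∀ i, P.g i x ≤ 0) ∧ ∀ j, P.h j x = 0}

/-- `x` is a local minimizer: it is feasible, and minimizes `f` among the feasible points of some
neighborhood of `x`. -/
def IsLocalMinimizer (P : NLP n p q) (x : EuclideanSpace ℝ (Fin n)) : Prop :=
  x ∈ P.feasibleSet ∧ IsLocalMinOn P.f P.feasibleSet x

/-- The indices of the inequality constraints that are active at `x`. -/
def activeSet (P : NLP n p q) (x : EuclideanSpace ℝ (Fin n)) : Set (Fin p) :=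
  {i | P.g i x = 0}

/-- The Lagrangian `L(x, λ, μ) = f(x) + ∑ λᵢ gᵢ(x) + ∑ μⱼ hⱼ(x)`. -/
def lagrangian (P : NLP n p q) (lam : Fin p → ℝ) (mu : Fin q → ℝ)
    (x : EuclideanSpace ℝ (Fin n)) : ℝ :=
  P.f x + ∑ i, lam i * P.g i x + ∑ j, mu j * P.h j x

/-- The set `Λ(x)` of the Lagrange multipliers at `x`. -/
def multiplierSet (P : NLP n p q) (x : EuclideanSpace ℝ (Fin n)) :
    Set ((Fin p → ℝ) × (Fin q → ℝ)) :=
  {m | gradient (P.lagrangian m.1 m.2) x = 0 ∧ (∀ i, 0 ≤ m.1 i) ∧ ∀ i, m.1 i * P.g i x = 0}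

/-- The Hessian `∇²L(x, λ, μ)` of the Lagrangian with respect to `x`. -/
def lagrangianHessian (P : NLP n p q) (x : EuclideanSpace ℝ (Fin n))
    (m : (Fin p → ℝ) × (Fin q → ℝ)) : Matrix (Fin n) (Fin n) ℝ :=
  hessianMatrix (P.lagrangian m.1 m.2) x

/-- The critical cone `C(x)`. -/
def criticalCone (P : NLP n p q) (x : EuclideanSpace ℝ (Fin n)) :
    Set (EuclideanSpace ℝ (Fin n)) :=
  {v | inner ℝ (gradient P.f x) v ≤ 0 ∧
    (∀ i ∈ P.activeSet x, inner ℝ (gradient (P.g i) x) v ≤ 0) ∧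
    ∀ j, inner ℝ (gradient (P.h j) x) v = 0}

/-- The Mangasarian-Fromovitz constraint qualification at `x`. -/
def MFCQ (P : NLP n p q) (x : EuclideanSpace ℝ (Fin n)) : Prop :=
  LinearIndependent ℝ (fun j => gradient (P.h j) x) ∧
    ∃ u : EuclideanSpace ℝ (Fin n),
      (∀ i ∈ P.activeSet x, inner ℝ (gradient (P.g i) x) u < 0) ∧
      ∀ j, inner ℝ (gradient (P.h j) x) u = 0

end NLP

end

/-!
Write `q_m(v) = vᵀ ∇²L(x, m) v` for a multiplier `m`. The proof exchanges the quantifiers in the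
classical second-order necessary condition "for each critical direction `v` there is a multiplier
`m` with `q_m(v) ≥ 0`", which is `NLP.exists_multiplier_quadForm_nonneg`.

That condition is proved by duality. If the second-order expansions of the objective and of the
active constraints along some parabola `x + t v + (t² / 2) z` were all negative (and those of the
equality constraints zero), metric regularity of the equality constraints would correct the parabola
to a feasible curve of smaller objective value (`NLP.not_exists_descent_parabola`). Hence the
corresponding affine system in `z` has no solution, and the theorem of the alternative
`exists_multipliers_of_forall_exists_nonneg` yields multipliers; the constraint qualification makes
the one of the objective positive.

For the exchange, the set of multipliers is convex and, by the constraint qualification, compact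
(`NLP.isCompact_multiplierSet`). By the Krein–Milman theorem the Hessian at every multiplier, not
only at the vertices, is a linear combination of `A₁, A₂, A₃`. Let `S = K ∪ -K`, a linear subspace
of dimension at least three. Brickman's theorem (`exists_forall_apply_self_eq_add`) says that the
joint range of the forms `vᵀ Aⱼ v` on `S` is a convex cone, because some combination is positive
definite. So the functions `m ↦ q_m(v)`, `v ∈ S`, are closed under nonnegative combinations on the
set of multipliers, and a separation argument (`exists_forall_nonneg_of_convexCone`) provides one
multiplier for all `v ∈ S`.

Brickman's theorem is reduced to the existence of a common zero of two quadratic forms `B` and `D`,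
where `D` takes both signs on the cone `B = 0`: in dimension three, any two points of that cone can
be joined within it, up to sign, without passing through the origin
(`exists_common_zero_of_neg_of_pos`).
-/

/-! ### Joint ranges of quadratic forms -/

/-- Two quadratic forms on a space of dimension at least three have a common nontrivial zero as soon
as one of them takes values of both signs on the zeros of the other: within the cone `B = 0`, a
nonzero multiple of `v₁` is joined to `v₂` by explicit paths avoiding the origin, on which `D`
changes sign. -/
theorem exists_common_zero_of_neg_of_pos {E : Type*} [AddCommGroup E] [Module ℝ E]
    (hE : ∀ a b : E, ∃ u, u ∉ Submodule.span ℝ {a, b})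
    (B D : LinearMap.BilinForm ℝ E) {v₁ v₂ : E} (hB₁ : B v₁ v₁ = 0) (hB₂ : B v₂ v₂ = 0)
    (hD₁ : D v₁ v₁ < 0) (hD₂ : 0 < D v₂ v₂) :
    ∃ v, v ≠ 0 ∧ B v v = 0 ∧ D v v = 0 := by
  -- the intermediate value theorem along a line segment in the plane of two vectors on whose
  -- span `B` vanishes
  have key : ∀ a b : E, D a a < 0 → 0 < D b b → B a a = 0 → B b b = 0 → B a b + B b a = 0 →
      ∃ v, v ≠ 0 ∧ B v v = 0 ∧ D v v = 0 := by
    intro a b ha hb hBa hBb hab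
    have hc : ContinuousOn (fun t : ℝ => (1 - t) ^ 2 * D a a + (1 - t) * t * (D a b + D b a)
        + t ^ 2 * D b b) (Set.Icc 0 1) := by fun_prop
    obtain ⟨t, -, ht⟩ := intermediate_value_Icc (zero_le_one' ℝ) hc
      (show (0 : ℝ) ∈ _ by constructor <;> simp [ha.le, hb.le])
    refine ⟨(1 - t) • a + t • b, ?_, ?_, ?_⟩
    · intro h0
      have hz : (1 - t) • a = -(t • b) := eq_neg_of_add_eq_zero_left h0
      have h1 : (1 - t) * ((1 - t) * D a a) = t * (t * D b b) := by
        simpa using congrArg (fun w => D w w) hz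
      by_cases h : t = 0
      · subst h; simp at h1; linarith
      · have : 0 < t * (t * D b b) := by
          rw [← mul_assoc]; exact mul_pos (mul_self_pos.2 h) hb
        nlinarith [mul_nonneg (mul_self_nonneg (1 - t)) (neg_nonneg.2 ha.le)]
    · simp only [map_add, map_smul, LinearMap.add_apply, LinearMap.smul_apply, smul_eq_mul, hBa, hBb]
      linear_combination (1 - t) * t * hab
    · simp only [map_add, map_smul, LinearMap.add_apply, LinearMap.smul_apply, smul_eq_mul]
      linear_combination ht
  by_cases hb : B v₁ v₂ + B v₂ v₁ = 0
  · exact key v₁ v₂ hD₁ hD₂ hB₁ hB₂ hb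
  obtain ⟨u₀, hu₀⟩ := hE v₁ v₂
  set b := B v₁ v₂ + B v₂ v₁ with hbdef
  -- a third vector, orthogonal to `v₁` and `v₂` for the polar form of `B`
  obtain ⟨u, hu, hu1, hu2⟩ : ∃ u, u ∉ Submodule.span ℝ {v₁, v₂} ∧ B v₁ u + B u v₁ = 0 ∧
      B v₂ u + B u v₂ = 0 := by
    refine ⟨u₀ - (((B v₂ u₀ + B u₀ v₂) / b) • v₁ + ((B v₁ u₀ + B u₀ v₁) / b) • v₂), ?_, ?_, ?_⟩
    · intro h
      refine hu₀ ((Submodule.sub_mem_iff_left _ ?_).1 h)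
      exact Submodule.mem_span_pair.2 ⟨_, _, rfl⟩
    · simp only [map_add, map_sub, map_smul, LinearMap.add_apply, LinearMap.sub_apply,
        LinearMap.smul_apply, smul_eq_mul, hB₁]
      field_simp
      rw [hbdef]; ring
    · simp only [map_add, map_sub, map_smul, LinearMap.add_apply, LinearMap.sub_apply,
        LinearMap.smul_apply, smul_eq_mul, hB₂]
      field_simp
      rw [hbdef]; ring
  by_cases he : B u u = 0
  · rcases lt_trichotomy (D u u) 0 with h | h | h
    · exact key u v₂ h hD₂ he hB₂ (by linarith)
    · exact ⟨u, fun h0 => hu (h0 ▸ Submodule.zero_mem _), he, h⟩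
    · exact key v₁ u hD₁ h hB₁ he hu1
  -- `B (x v₁ + y v₂ + z u) = b x y + (B u u) z²`; the conic is parametrized by
  -- `(x, y, z) = (κ (1 - t)², t², (1 - t) t)`
  set κ := -(B u u) / b with hκ
  have hκ0 : κ ≠ 0 := div_ne_zero (neg_ne_zero.2 he) hb
  have hκb : κ * b = - B u u := by rw [hκ]; field_simp
  have hc : ContinuousOn (fun t : ℝ => (κ * (1 - t) ^ 2) ^ 2 * D v₁ v₁ + (t ^ 2) ^ 2 * D v₂ v₂
      + ((1 - t) * t) ^ 2 * D u u + (κ * (1 - t) ^ 2) * t ^ 2 * (D v₁ v₂ + D v₂ v₁)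
      + (κ * (1 - t) ^ 2) * ((1 - t) * t) * (D v₁ u + D u v₁)
      + t ^ 2 * ((1 - t) * t) * (D v₂ u + D u v₂)) (Set.Icc 0 1) := by fun_prop
  obtain ⟨t, -, ht⟩ := intermediate_value_Icc (zero_le_one' ℝ) hc
    (show (0 : ℝ) ∈ _ by
      constructor
      · simpa using mul_nonpos_of_nonneg_of_nonpos (sq_nonneg κ) hD₁.le
      · simp [hD₂.le])
  refine ⟨(κ * (1 - t) ^ 2) • v₁ + t ^ 2 • v₂ + ((1 - t) * t) • u, ?_, ?_, ?_⟩
  · intro h0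
    by_cases hst : (1 - t) * t = 0
    · rcases mul_eq_zero.1 hst with h | h
      · have h1 : t = 1 := by linarith
        subst h1
        have : v₂ = 0 := by simpa using h0
        simp [this] at hD₂
      · subst h
        have : v₁ = 0 := by simpa [hκ0] using h0
        simp [this] at hD₁
    · apply hu
      rw [← Submodule.smul_mem_iff _ hst, eq_neg_of_add_eq_zero_right h0]
      exact Submodule.neg_mem _ (Submodule.mem_span_pair.2 ⟨_, _, rfl⟩)
  · simp only [map_add, map_smul, LinearMap.add_apply, LinearMap.smul_apply, smul_eq_mul, hB₁, hB₂]
    linear_combination (κ * (1 - t) ^ 2) * ((1 - t) * t) * hu1 + t ^ 2 * ((1 - t) * t) * hu2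
      + (1 - t) ^ 2 * t ^ 2 * hκb + (κ * (1 - t) ^ 2) * t ^ 2 * (hbdef.symm)
  · simp only [map_add, map_smul, LinearMap.add_apply, LinearMap.smul_apply, smul_eq_mul]
    linear_combination ht

/-- **Brickman's theorem** in conic form: the joint range of three quadratic forms, some linear
combination of which is positive definite, on a space of dimension at least three is closed under
addition (hence a convex cone). -/
theorem exists_forall_apply_self_eq_add {E : Type*} [AddCommGroup E] [Module ℝ E]
    (hE : ∀ a b : E, ∃ u, u ∉ Submodule.span ℝ {a, b})
    (Q : Fin 3 → LinearMap.BilinForm ℝ E) (s : Fin 3 → ℝ)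
    (hs : ∀ v, v ≠ 0 → 0 < ∑ j, s j * Q j v v) (v₁ v₂ : E) :
    ∃ v, ∀ j, Q j v v = Q j v₁ v₁ + Q j v₂ v₂ := by
  -- if the value vector at `v` is parallel to the desired one, then `v` can be rescaled
  have scale : ∀ (v : E) (w : Fin 3 → ℝ), v ≠ 0 → 0 ≤ ∑ j, s j * w j →
      (∀ i j, Q i v v * w j = Q j v v * w i) → ∃ v', ∀ j, Q j v' v' = w j := by
    intro v w hv hw hpar
    have hσ := hs v hv
    refine ⟨√((∑ j, s j * w j) / ∑ j, s j * Q j v v) • v, fun j => ?_⟩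
    simp only [map_smul, LinearMap.smul_apply, smul_eq_mul]
    rw [← mul_assoc, Real.mul_self_sqrt (div_nonneg hw hσ.le), div_mul_eq_mul_div,
      div_eq_iff hσ.ne', Finset.sum_mul, Finset.mul_sum]
    exact Finset.sum_congr rfl fun i _ => by linear_combination s i * hpar j i
  have hnn : ∀ v, 0 ≤ ∑ j, s j * Q j v v := fun v => by
    by_cases h : v = 0
    · simp [h]
    · exact (hs v h).le
  by_cases hv₁ : v₁ = 0
  · exact ⟨v₂, by simp [hv₁]⟩
  have hsum : 0 ≤ ∑ j, s j * (Q j v₁ v₁ + Q j v₂ v₂) := by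
    simp only [mul_add, Finset.sum_add_distrib]
    exact add_nonneg (hnn _) (hnn _)
  set a : Fin 3 → ℝ := fun j => Q j v₁ v₁ with ha
  set b : Fin 3 → ℝ := fun j => Q j v₂ v₂ with hb
  set c := crossProduct a b with hc
  have c0 : c 0 = a 1 * b 2 - a 2 * b 1 := by simp [hc, cross_apply]
  have c1 : c 1 = a 2 * b 0 - a 0 * b 2 := by simp [hc, cross_apply]
  have c2 : c 2 = a 0 * b 1 - a 1 * b 0 := by simp [hc, cross_apply]
  by_cases hc0 : c = 0
  · refine scale v₁ (fun j => a j + b j) hv₁ hsum ?_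
    rw [hc0] at c0 c1 c2
    simp only [Pi.zero_apply] at c0 c1 c2
    intro i j
    change a i * (a j + b j) = a j * (a i + b i)
    fin_cases i <;> fin_cases j <;> simp <;> linarith
  have hN : 0 < c 0 ^ 2 + c 1 ^ 2 + c 2 ^ 2 := by
    by_contra! h
    apply hc0
    funext j
    fin_cases j <;> simp <;> nlinarith [sq_nonneg (c 0), sq_nonneg (c 1), sq_nonneg (c 2)]
  -- the common kernel of the functionals `c = a × b` and `d = c × (a + b)` is spanned by `a + b`
  set d := crossProduct c (a + b) with hd
  have d0 : d 0 = c 1 * (a 2 + b 2) - c 2 * (a 1 + b 1) := by simp [hd, cross_apply]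
  have d1 : d 1 = c 2 * (a 0 + b 0) - c 0 * (a 2 + b 2) := by simp [hd, cross_apply]
  have d2 : d 2 = c 0 * (a 1 + b 1) - c 1 * (a 0 + b 0) := by simp [hd, cross_apply]
  have happ : ∀ (e : Fin 3 → ℝ) (v : E), (∑ j, e j • Q j : LinearMap.BilinForm ℝ E) v v
      = e 0 * Q 0 v v + e 1 * Q 1 v v + e 2 * Q 2 v v := by
    intro e v; simp [Fin.sum_univ_three]
  obtain ⟨v, hv, hcv, hdv⟩ := exists_common_zero_of_neg_of_pos hE (∑ j, c j • Q j)
    (∑ j, d j • Q j) (v₁ := v₁) (v₂ := v₂)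
    (by rw [happ]; change c 0 * a 0 + c 1 * a 1 + c 2 * a 2 = 0; rw [c0, c1, c2]; ring)
    (by rw [happ]; change c 0 * b 0 + c 1 * b 1 + c 2 * b 2 = 0; rw [c0, c1, c2]; ring)
    (by
      rw [happ]; change d 0 * a 0 + d 1 * a 1 + d 2 * a 2 < 0
      have : d 0 * a 0 + d 1 * a 1 + d 2 * a 2 = -(c 0 ^ 2 + c 1 ^ 2 + c 2 ^ 2) := by
        rw [d0, d1, d2, c0, c1, c2]; ring
      linarith)
    (by
      rw [happ]; change 0 < d 0 * b 0 + d 1 * b 1 + d 2 * b 2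
      have : d 0 * b 0 + d 1 * b 1 + d 2 * b 2 = c 0 ^ 2 + c 1 ^ 2 + c 2 ^ 2 := by
        rw [d0, d1, d2, c0, c1, c2]; ring
      linarith)
  rw [happ] at hcv hdv
  refine scale v (fun j => a j + b j) hv hsum ?_
  have hcw : c 0 * (a 0 + b 0) + c 1 * (a 1 + b 1) + c 2 * (a 2 + b 2) = 0 := by
    rw [c0, c1, c2]; ring
  rw [d0, d1, d2] at hdv
  generalize c 0 = C0 at *
  generalize c 1 = C1 at *
  generalize c 2 = C2 at *
  have e0 : Q 1 v v * (a 2 + b 2) - Q 2 v v * (a 1 + b 1) = 0 := by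
    refine (mul_eq_zero.1 ?_).resolve_left hN.ne'
    linear_combination -C0 * hdv - (C1 * Q 2 v v - C2 * Q 1 v v) * hcw
      + (C1 * (a 2 + b 2) - C2 * (a 1 + b 1)) * hcv
  have e1 : Q 2 v v * (a 0 + b 0) - Q 0 v v * (a 2 + b 2) = 0 := by
    refine (mul_eq_zero.1 ?_).resolve_left hN.ne'
    linear_combination -C1 * hdv - (C2 * Q 0 v v - C0 * Q 2 v v) * hcw
      + (C2 * (a 0 + b 0) - C0 * (a 2 + b 2)) * hcv
  have e2 : Q 0 v v * (a 1 + b 1) - Q 1 v v * (a 0 + b 0) = 0 := by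
    refine (mul_eq_zero.1 ?_).resolve_left hN.ne'
    linear_combination -C2 * hdv - (C0 * Q 1 v v - C1 * Q 0 v v) * hcw
      + (C0 * (a 1 + b 1) - C1 * (a 0 + b 0)) * hcv
  intro i j
  fin_cases i <;> fin_cases j <;> simp <;> linarith

/-! ### Separation: a minimax principle and a theorem of the alternative -/

/-- A linear functional on `ι → ℝ` is given by its values on the standard basis. -/
theorem map_eq_sum_map_single_mul {ι : Type*} [Fintype ι] [DecidableEq ι]
    (φ : (ι → ℝ) →ₗ[ℝ] ℝ) (w : ι → ℝ) : φ w = ∑ i, φ (Pi.single i 1) * w i := by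
  conv_lhs => rw [← Finset.univ_sum_single w]
  rw [map_sum]
  refine Finset.sum_congr rfl fun i _ => ?_
  have : Pi.single i (w i) = w i • (Pi.single i 1 : ι → ℝ) := by
    rw [← Pi.single_smul, smul_eq_mul, mul_one]
  rw [this, map_smul, smul_eq_mul, mul_comm]

/-- A minimax principle: if a family of continuous functions, affine along convex combinations, is
closed (on a compact convex set) under nonnegative combinations and each member is nonnegative
somewhere on that set, then all members are nonnegative at a common point. By compactness this
concerns finite subfamilies, where a hyperplane separating the values from the nonnegative orthant
would be a nonnegative combination that is negative everywhere. -/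
theorem exists_forall_nonneg_of_convexCone {X ι : Type*} [AddCommGroup X] [Module ℝ X]
    [TopologicalSpace X] [Nonempty ι] {Λ : Set X} (hcomp : IsCompact Λ) (hconv : Convex ℝ Λ)
    (F : ι → X → ℝ) (hF : ∀ i, Continuous (F i))
    (haff : ∀ i, ∀ m m' : X, ∀ a b : ℝ, a + b = 1 →
      F i (a • m + b • m') = a * F i m + b * F i m')
    (hadd : ∀ i k, ∃ l, ∀ m ∈ Λ, F l m = F i m + F k m)
    (hsmul : ∀ i, ∀ c : ℝ, 0 ≤ c → ∃ l, ∀ m ∈ Λ, F l m = c * F i m)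
    (hpt : ∀ i, ∃ m ∈ Λ, 0 ≤ F i m) :
    ∃ m ∈ Λ, ∀ i, 0 ≤ F i m := by
  suffices h : (Λ ∩ ⋂ i, {m | 0 ≤ F i m}).Nonempty by
    obtain ⟨m, hm, hm'⟩ := h
    exact ⟨m, hm, fun i => Set.mem_iInter.1 hm' i⟩
  refine hcomp.inter_iInter_nonempty _ (fun i => isClosed_le continuous_const (hF i)) fun u => ?_
  by_contra hemp
  classical
  let G : X → u → ℝ := fun m i => F i m
  have hG : Continuous G := continuous_pi fun i => hF i
  have hconv' : Convex ℝ (G '' Λ) := by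
    rintro _ ⟨m, hm, rfl⟩ _ ⟨m', hm', rfl⟩ a b ha hb hab
    exact ⟨a • m + b • m', hconv hm hm' ha hb hab, funext fun i => haff i m m' a b hab⟩
  obtain ⟨φ, r, t, h1, h2, h3⟩ := geometric_hahn_banach_compact_closed hconv' (hcomp.image hG)
    (convex_Ici (0 : u → ℝ)) isClosed_Ici (by
      rw [Set.disjoint_left]
      rintro _ ⟨m, hm, rfl⟩ h0
      refine hemp ⟨m, hm, Set.mem_iInter₂.2 fun i hi => ?_⟩
      exact (Set.mem_Ici.1 h0) ⟨i, hi⟩)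
  have ht : t < 0 := by simpa using h3 0 (Set.mem_Ici.2 le_rfl)
  have hcoef : ∀ i, 0 ≤ φ (Pi.single i 1) := by
    intro i
    by_contra! hneg
    have := h3 ((t / φ (Pi.single i 1)) • Pi.single i 1) (Set.mem_Ici.2
      (smul_nonneg (div_nonneg_of_nonpos ht.le hneg.le) (Pi.single_nonneg.2 zero_le_one)))
    rw [map_smul, smul_eq_mul, div_mul_cancel₀ _ hneg.ne] at this
    exact lt_irrefl _ this
  have hcomb : ∀ w : Finset u, ∃ l, ∀ m ∈ Λ, F l m = ∑ i ∈ w, φ (Pi.single i 1) * F i m := by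
    intro w
    induction w using Finset.induction_on with
    | empty =>
      obtain ⟨l, hl⟩ := hsmul (Classical.arbitrary ι) 0 le_rfl
      exact ⟨l, fun m hm => by simp [hl m hm]⟩
    | insert i w hi ih =>
      obtain ⟨l, hl⟩ := ih
      obtain ⟨k, hk⟩ := hsmul i _ (hcoef i)
      obtain ⟨j, hj⟩ := hadd k l
      exact ⟨j, fun m hm => by rw [hj m hm, hk m hm, hl m hm, Finset.sum_insert hi]⟩
  obtain ⟨l, hl⟩ := hcomb Finset.univ
  obtain ⟨m, hm, hlm⟩ := hpt l
  have hlt := h1 _ ⟨m, hm, rfl⟩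
  have hsum : φ (G m) = ∑ i, φ (Pi.single i 1) * F i m :=
    map_eq_sum_map_single_mul (φ : (u → ℝ) →ₗ[ℝ] ℝ) (G m)
  rw [hl m hm, ← hsum] at hlm
  linarith

/-- A theorem of the alternative: if a finite system of strict affine inequalities has no solution
in the common kernel of the functionals `e j`, then some nontrivial nonnegative combination of the
inequalities is contradictory. -/
theorem exists_multipliers_of_forall_exists_nonneg {E ι κ : Type*} [AddCommGroup E] [Module ℝ E]
    [Fintype ι] [Finite κ] (a : ι → E →ₗ[ℝ] ℝ) (b : ι → ℝ) (e : κ → E →ₗ[ℝ] ℝ)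
    (h : ∀ z, (∀ j, e j z = 0) → ∃ i, 0 ≤ a i z + b i) :
    ∃ y : ι → ℝ, (∀ i, 0 ≤ y i) ∧ y ≠ 0 ∧ 0 ≤ ∑ i, y i * b i ∧
      ∑ i, y i • a i ∈ Submodule.span ℝ (Set.range e) := by
  let N : Submodule ℝ E := ⨅ j, LinearMap.ker (e j)
  have hN : ∀ z, z ∈ N ↔ ∀ j, e j z = 0 := by simp [N]
  let T : E → ι → ℝ := fun z i => a i z + b i
  have hconv : Convex ℝ (T '' N) := by
    rintro _ ⟨z, hz, rfl⟩ _ ⟨z', hz', rfl⟩ r s - - hrs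
    refine ⟨r • z + s • z', N.add_mem (N.smul_mem _ hz) (N.smul_mem _ hz'), funext fun i => ?_⟩
    simp only [T, map_add, map_smul, smul_eq_mul, Pi.add_apply, Pi.smul_apply]
    linear_combination (-b i) * hrs
  have hneg : {w : ι → ℝ | ∀ i, w i < 0} = Set.pi Set.univ fun _ => Set.Iio 0 := by
    ext; simp
  obtain ⟨φ, u, h1, h2⟩ := geometric_hahn_banach_open (s := {w : ι → ℝ | ∀ i, w i < 0})
    (t := T '' N)
    (by rw [hneg]; exact convex_pi fun _ _ => convex_Iio 0)
    (by rw [hneg]; exact isOpen_set_pi Set.finite_univ fun _ _ => isOpen_Iio) hconv (by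
      rw [Set.disjoint_left]
      rintro _ hw ⟨z, hz, rfl⟩
      obtain ⟨i, hi⟩ := h z ((hN z).1 hz)
      exact (hw i).not_ge hi)
  classical
  have hφ : ∀ w, φ w = ∑ i, φ (Pi.single i 1) * w i :=
    map_eq_sum_map_single_mul (φ : (ι → ℝ) →ₗ[ℝ] ℝ)
  -- the functional is bounded above by `u` on the closed orthant
  have hle : ∀ w : ι → ℝ, (∀ i, w i ≤ 0) → φ w ≤ u := by
    intro w hw
    have ht : Filter.Tendsto (fun t : ℝ => φ (w + t • fun _ => -1)) (nhdsWithin 0 (Set.Ioi 0))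
        (nhds (φ w)) := by
      have : Continuous fun t : ℝ => φ (w + t • fun _ => -1) := by fun_prop
      simpa using (this.tendsto 0).mono_left nhdsWithin_le_nhds
    refine le_of_tendsto ht ?_
    filter_upwards [self_mem_nhdsWithin] with t ht
    refine (h1 _ fun i => ?_).le
    have : 0 < t := ht
    simp only [Pi.add_apply, Pi.smul_apply, smul_eq_mul]
    linarith [hw i]
  have hu : 0 ≤ u := by simpa using hle 0 (by simp)
  refine ⟨fun i => φ (Pi.single i 1), fun i => ?_, ?_, ?_, ?_⟩
  · by_contra! hlt
    have := hle (((u + 1) / φ (Pi.single i 1)) • Pi.single i 1) (fun j => by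
      have h0 : (u + 1) / φ (Pi.single i 1) ≤ 0 :=
        div_nonpos_of_nonneg_of_nonpos (by linarith) hlt.le
      have h1 : (0 : ℝ) ≤ (Pi.single i 1 : ι → ℝ) j :=
        (Pi.single_nonneg.2 zero_le_one : (0 : ι → ℝ) ≤ Pi.single i 1) j
      simpa using mul_nonpos_of_nonpos_of_nonneg h0 h1)
    rw [map_smul, smul_eq_mul, div_mul_cancel₀ _ hlt.ne] at this
    linarith
  · intro h0
    have hz : ∀ w, φ w = 0 := fun w => by
      rw [hφ]; exact Finset.sum_eq_zero fun i _ => by rw [congrFun h0 i]; simp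
    have := h1 (fun _ => -1) (fun _ => by norm_num)
    have h3 := h2 _ ⟨0, N.zero_mem, rfl⟩
    rw [hz] at this h3
    linarith
  · have h3 := h2 _ ⟨0, N.zero_mem, rfl⟩
    rw [hφ] at h3
    simp only [T, map_zero, zero_add] at h3
    exact hu.trans h3
  · refine mem_span_of_iInf_ker_le_ker fun z hz => ?_
    have hz' : z ∈ N := hz
    -- an affine function bounded below on a subspace has zero linear part
    have hval : ∀ r : ℝ, u ≤ r * (∑ i, φ (Pi.single i 1) * a i z)
        + ∑ i, φ (Pi.single i 1) * b i := by
      intro r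
      have h3 := h2 _ ⟨r • z, N.smul_mem r hz', rfl⟩
      rw [hφ] at h3
      refine h3.trans_eq ?_
      rw [Finset.mul_sum, ← Finset.sum_add_distrib]
      refine Finset.sum_congr rfl fun i _ => ?_
      simp only [T, map_smul, smul_eq_mul]; ring
    rw [LinearMap.mem_ker]
    simp only [LinearMap.sum_apply, LinearMap.smul_apply, smul_eq_mul]
    by_contra hne
    have := hval ((u - 1 - ∑ i, φ (Pi.single i 1) * b i) / ∑ i, φ (Pi.single i 1) * a i z)
    rw [div_mul_cancel₀ _ hne] at this
    linarith

/-! ### Second-order expansions and curves of zeros -/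

open Filter Topology Asymptotics in
/-- The second-order Taylor expansion at `t = 0` along the parabola `x + t v + (t² / 2) z`. -/
theorem isLittleO_taylor_parabola {E : Type*} [NormedAddCommGroup E] [NormedSpace ℝ E] {F : E → ℝ}
    (hF : ContDiff ℝ 2 F) (x v z : E) :
    (fun t : ℝ => F (x + t • v + (t ^ 2 / 2) • z) - F x - t * fderiv ℝ F x v
      - t ^ 2 / 2 * (fderiv ℝ F x z + fderiv ℝ (fderiv ℝ F) x v v)) =o[𝓝 0] fun t => t ^ 2 := by
  set y : ℝ → E := fun t => x + t • v + (t ^ 2 / 2) • z with hy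
  have hyd : ∀ t, HasDerivAt y (v + t • z) t := by
    intro t
    have h1 : HasDerivAt (fun t : ℝ => t • v) v t := by
      simpa using (hasDerivAt_id t).smul_const v
    have h2 : HasDerivAt (fun t : ℝ => (t ^ 2 / 2) • z) (t • z) t := by
      have := ((hasDerivAt_pow 2 t).div_const 2).smul_const z
      convert this using 2
      simp
    exact (h1.const_add x).add h2
  have hyc : ContDiff ℝ 2 y := by fun_prop
  have hφ : ContDiff ℝ 2 (F ∘ y) := hF.comp hyc
  have hd1 : deriv (F ∘ y) = fun t => fderiv ℝ F (y t) (v + t • z) := by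
    funext t
    exact (((hF.differentiable (by norm_num)) (y t)).hasFDerivAt.comp_hasDerivAt t (hyd t)).deriv
  have hy0 : y 0 = x := by simp [hy]
  have hd2 : deriv (deriv (F ∘ y)) 0 = fderiv ℝ (fderiv ℝ F) x v v + fderiv ℝ F x z := by
    rw [hd1]
    have hF' : Differentiable ℝ (fderiv ℝ F) :=
      (hF.fderiv_right (m := 1) (by norm_num)).differentiable (by norm_num)
    have h1 : HasDerivAt (fun t => fderiv ℝ F (y t)) (fderiv ℝ (fderiv ℝ F) x v) 0 := by
      have := (hF' (y 0)).hasFDerivAt.comp_hasDerivAt 0 (hyd 0)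
      rw [hy0, zero_smul, add_zero] at this
      exact this
    have h2 : HasDerivAt (fun t : ℝ => v + t • z) z 0 := by
      simpa using ((hasDerivAt_id (0 : ℝ)).smul_const z).const_add v
    have := (h1.clm_apply h2).deriv
    simpa [hy0] using this
  have hT := taylor_isLittleO_univ (x₀ := (0 : ℝ)) (n := 2) (by exact_mod_cast hφ)
  refine (hT.congr' (Eventually.of_forall fun t => ?_) (Eventually.of_forall fun t => by simp))
  simp only [taylorWithinEval_succ, taylor_within_zero_eval, iteratedDerivWithin_univ,
    iteratedDeriv_succ, iteratedDeriv_zero, hd2]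
  rw [hd1]
  simp only [Function.comp_apply, hy0, smul_eq_mul, zero_smul, add_zero]
  simp
  ring

open Filter Topology Asymptotics in
/-- The second-order Taylor expansion along a curve that is tangent to second order to the parabola
`x + t v + (t² / 2) z`. -/
theorem isLittleO_taylor_curve {E : Type*} [NormedAddCommGroup E] [NormedSpace ℝ E] {F : E → ℝ}
    (hF : ContDiff ℝ 2 F) {x v z : E} {ξ : ℝ → E}
    (hξ : (fun t => ξ t - (x + t • v + (t ^ 2 / 2) • z)) =o[𝓝[>] 0] fun t => t ^ 2) :
    (fun t : ℝ => F (ξ t) - F x - t * fderiv ℝ F x v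
      - t ^ 2 / 2 * (fderiv ℝ F x z + fderiv ℝ (fderiv ℝ F) x v v))
      =o[𝓝[>] 0] fun t => t ^ 2 := by
  have hy : Tendsto (fun t : ℝ => x + t • v + (t ^ 2 / 2) • z) (𝓝[>] 0) (𝓝 x) := by
    have : Continuous fun t : ℝ => x + t • v + (t ^ 2 / 2) • z := by fun_prop
    simpa using (this.tendsto 0).mono_left nhdsWithin_le_nhds
  have h0 : Tendsto (fun t : ℝ => t ^ 2) (𝓝[>] 0) (𝓝 0) := by
    have : Continuous fun t : ℝ => t ^ 2 := by fun_prop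
    simpa using (this.tendsto 0).mono_left nhdsWithin_le_nhds
  have hξx : Tendsto ξ (𝓝[>] 0) (𝓝 x) := by
    simpa using (hξ.trans_tendsto h0).add hy
  have hO := (hF.contDiffAt.hasStrictFDerivAt (x := x) (by norm_num)).isBigO_sub
  have h1 := ((hO.comp_tendsto (hξx.prodMk_nhds hy))).trans_isLittleO hξ
  have h2 := (isLittleO_taylor_parabola hF x v z).mono (nhdsWithin_le_nhds (s := Set.Ioi 0))
  refine (h1.add h2).congr_left fun t => ?_
  simp only [Function.comp_apply]
  ring

open Filter Topology Asymptotics in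
/-- A function decreases along a curve tangent to second order to `x + t v + (t² / 2) z` if its
first derivative along `v` is negative, or vanishes while the second-order term is negative. -/
theorem eventually_lt_along_curve {E : Type*} [NormedAddCommGroup E] [NormedSpace ℝ E]
    {F : E → ℝ} (hF : ContDiff ℝ 2 F) {x v z : E} {ξ : ℝ → E}
    (hξ : (fun t => ξ t - (x + t • v + (t ^ 2 / 2) • z)) =o[𝓝[>] 0] fun t => t ^ 2)
    (hv : fderiv ℝ F x v ≤ 0)
    (hz : fderiv ℝ F x v = 0 → fderiv ℝ F x z + fderiv ℝ (fderiv ℝ F) x v v < 0) :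
    ∀ᶠ t in 𝓝[>] 0, F (ξ t) < F x := by
  have hT := isLittleO_taylor_curve hF hξ
  set d := fderiv ℝ F x v
  set w := fderiv ℝ F x z + fderiv ℝ (fderiv ℝ F) x v v
  rcases hv.lt_or_eq with hd | hd
  · have hsmall : ∀ᶠ t : ℝ in 𝓝[>] 0, t * (w / 2 + 1) < -d := by
      have : Continuous fun t : ℝ => t * (w / 2 + 1) := by fun_prop
      exact ((this.tendsto 0).mono_left nhdsWithin_le_nhds).eventually_lt_const
        (by simpa using hd)
    filter_upwards [hT.bound one_pos, hsmall, self_mem_nhdsWithin] with t h1 h2 ht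
    have ht : 0 < t := ht
    rw [Real.norm_eq_abs, Real.norm_eq_abs, abs_of_nonneg (sq_nonneg t)] at h1
    have := (abs_le.1 h1).2
    nlinarith
  · have hw := hz hd
    filter_upwards [hT.bound (show 0 < -w / 4 by linarith), self_mem_nhdsWithin] with t h1 ht
    have ht : 0 < t := ht
    rw [Real.norm_eq_abs, Real.norm_eq_abs, abs_of_nonneg (sq_nonneg t)] at h1
    have := (abs_le.1 h1).2
    rw [hd] at this
    nlinarith [mul_pos (pow_pos ht 2) (neg_pos.2 hw)]

open Filter Topology in
/-- Metric regularity: near a zero at which the strict derivative is onto, the distance to the zero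
set is bounded by a multiple of the residual. -/
theorem exists_zero_norm_sub_le_of_surjective {E F : Type*} [NormedAddCommGroup E]
    [NormedSpace ℝ E] [CompleteSpace E] [NormedAddCommGroup F] [NormedSpace ℝ F] [CompleteSpace F]
    {H : E → F} {H' : E →L[ℝ] F} {x : E} (hH : HasStrictFDerivAt H H' x) (hsurj : H'.range = ⊤)
    (hx : H x = 0) :
    ∃ C : ℝ, ∀ᶠ y in 𝓝 x, ∃ x', H x' = 0 ∧ ‖x' - y‖ ≤ C * ‖H y‖ := by
  let R := H'.nonlinearRightInverseOfSurjective hsurj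
  have hR : 0 < (R.nnnorm : ℝ) := H'.nonlinearRightInverseOfSurjective_nnnorm_pos hsurj
  obtain ⟨s, hs, happ⟩ := hH.approximates_deriv_on_nhds (c := R.nnnorm⁻¹ / 2)
    (Or.inr (half_pos (inv_pos.2 hR)))
  obtain ⟨r, hr, hrs⟩ := Metric.nhds_basis_ball.mem_iff.1 hs
  refine ⟨2 * R.nnnorm, ?_⟩
  have hcont : Tendsto (fun y => dist y x + 2 * R.nnnorm * ‖H y‖) (𝓝 x) (𝓝 0) := by
    have h : ContinuousAt (fun y => dist y x + 2 * R.nnnorm * ‖H y‖) x :=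
      (continuous_id.dist continuous_const).continuousAt.add
        (continuousAt_const.mul hH.continuousAt.norm)
    simpa [ContinuousAt, hx] using h
  filter_upwards [hcont.eventually_lt_const hr] with y hy
  have hsub : Metric.closedBall y (2 * R.nnnorm * ‖H y‖) ⊆ s := by
    intro w hw
    apply hrs
    rw [Metric.mem_ball]
    rw [Metric.mem_closedBall] at hw
    linarith [dist_triangle w y x]
  obtain ⟨x', hx', h0⟩ := happ.surjOn_closedBall_of_nonlinearRightInverse R
    (by positivity) hsub (show (0 : F) ∈ _ by
      rw [Metric.mem_closedBall, dist_zero_left]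
      apply le_of_eq
      push_cast
      field_simp
      ring)
  exact ⟨x', h0, by rwa [← dist_eq_norm]⟩

theorem exists_forall_apply_eq_of_linearIndependent {E κ : Type*} [AddCommGroup E] [Module ℝ E]
    [Fintype κ] {e : κ → E →ₗ[ℝ] ℝ} (he : LinearIndependent ℝ e) (c : κ → ℝ) :
    ∃ z, ∀ j, e j z = c j := by
  suffices h : LinearMap.range (LinearMap.pi e) = ⊤ by
    obtain ⟨z, hz⟩ := LinearMap.range_eq_top.1 h c
    exact ⟨z, congrFun hz⟩
  classical
  by_contra hne
  obtain ⟨ψ, hψ0, hψ⟩ := Submodule.exists_le_ker_of_lt_top _ (lt_top_iff_ne_top.2 hne)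
  refine hψ0 (LinearMap.pi_ext' fun j => LinearMap.ext_ring ?_)
  refine Fintype.linearIndependent_iff.1 he (fun j => ψ (Pi.single j 1))
    (LinearMap.ext fun z => ?_) j
  have h0 : ψ (LinearMap.pi e z) = 0 := hψ ⟨z, rfl⟩
  rw [map_eq_sum_map_single_mul ψ (LinearMap.pi e z)] at h0
  simpa using h0

open Filter Topology Asymptotics in
/-- A curve of zeros of `H` with prescribed first- and second-order terms `v` and `z`, which exists
as soon as the expansion of `H` along the parabola `x + t v + (t² / 2) z` vanishes to second
order. -/
theorem exists_curve_of_zeros {E : Type*} [NormedAddCommGroup E]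
    [NormedSpace ℝ E] [CompleteSpace E] {κ : Type*} [Fintype κ] {h : κ → E → ℝ}
    (hh : ∀ j, ContDiff ℝ 2 (h j)) {x v z : E}
    (hli : LinearIndependent ℝ fun j => (fderiv ℝ (h j) x : E →ₗ[ℝ] ℝ)) (hx : ∀ j, h j x = 0)
    (hv : ∀ j, fderiv ℝ (h j) x v = 0)
    (hz : ∀ j, fderiv ℝ (h j) x z + fderiv ℝ (fderiv ℝ (h j)) x v v = 0) :
    ∃ ξ : ℝ → E, (fun t => ξ t - (x + t • v + (t ^ 2 / 2) • z)) =o[𝓝[>] 0] (fun t => t ^ 2) ∧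
      ∀ᶠ t in 𝓝[>] 0, ∀ j, h j (ξ t) = 0 := by
  let H : E → κ → ℝ := fun y j => h j y
  let H' : E →L[ℝ] κ → ℝ := ContinuousLinearMap.pi fun j => fderiv ℝ (h j) x
  have hH : HasStrictFDerivAt H H' x := hasStrictFDerivAt_pi.2 fun j =>
    (hh j).contDiffAt.hasStrictFDerivAt (by norm_num)
  have hsurj : H'.range = ⊤ := by
    refine LinearMap.range_eq_top.2 fun c => ?_
    obtain ⟨z, hz⟩ := exists_forall_apply_eq_of_linearIndependent hli c
    exact ⟨z, funext hz⟩
  obtain ⟨C, hC⟩ := exists_zero_norm_sub_le_of_surjective hH hsurj (funext hx)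
  have hy : Tendsto (fun t : ℝ => x + t • v + (t ^ 2 / 2) • z) (𝓝[>] 0) (𝓝 x) := by
    have : Continuous fun t : ℝ => x + t • v + (t ^ 2 / 2) • z := by fun_prop
    simpa using (this.tendsto 0).mono_left nhdsWithin_le_nhds
  have hev := hy.eventually hC
  have hex : ∃ ξ : ℝ → E, ∀ᶠ t in 𝓝[>] (0 : ℝ), H (ξ t) = 0 ∧
      ‖ξ t - (x + t • v + (t ^ 2 / 2) • z)‖ ≤ C * ‖H (x + t • v + (t ^ 2 / 2) • z)‖ := by
    simpa only [eventually_iff, Classical.skolem] using hev.choice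
  obtain ⟨ξ, hξ⟩ := hex
  refine ⟨ξ, ?_, hξ.mono fun t ht j => congrFun ht.1 j⟩
  have hO : (fun t => ξ t - (x + t • v + (t ^ 2 / 2) • z)) =O[𝓝[>] 0]
      fun t => H (x + t • v + (t ^ 2 / 2) • z) :=
    IsBigO.of_bound C (hξ.mono fun t ht => ht.2)
  refine hO.trans_isLittleO (isLittleO_pi.2 fun j => ?_)
  refine ((isLittleO_taylor_parabola (hh j) x v z).mono
    (nhdsWithin_le_nhds (s := Set.Ioi 0))).congr_left fun t => ?_
  simp [H, hx, hv, hz]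

/-! ### Gradients, Hessians and the Lagrangian -/

theorem inner_gradient_eq_fderiv {E : Type*} [NormedAddCommGroup E] [InnerProductSpace ℝ E]
    [CompleteSpace E] (F : E → ℝ) (x v : E) : inner ℝ (gradient F x) v = fderiv ℝ F x v := by
  rw [gradient, InnerProductSpace.toDual_symm_apply]

theorem gradient_eq_zero_iff_fderiv_eq_zero {E : Type*} [NormedAddCommGroup E]
    [InnerProductSpace ℝ E] [CompleteSpace E] (F : E → ℝ) (x : E) :
    gradient F x = 0 ↔ fderiv ℝ F x = 0 := by
  rw [gradient, map_eq_zero_iff _ (LinearIsometryEquiv.injective _)]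

theorem quadForm_hessianMatrix {n : ℕ} (F : EuclideanSpace ℝ (Fin n) → ℝ)
    (x v : EuclideanSpace ℝ (Fin n)) :
    quadForm (hessianMatrix F x) v = fderiv ℝ (fderiv ℝ F) x v v := by
  have hv : v = ∑ i, v i • EuclideanSpace.single i (1 : ℝ) := by
    ext j
    simp [Finset.sum_apply, Pi.single_apply]
  conv_rhs => rw [hv]
  simp only [quadForm, hessianMatrix, dotProduct, Matrix.mulVec, Matrix.of_apply, map_sum, map_smul,
    _root_.sum_apply, _root_.smul_apply, smul_eq_mul, Finset.mul_sum]
  refine Finset.sum_comm.trans (Finset.sum_congr rfl fun i _ => Finset.sum_congr rfl fun j _ => ?_)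
  ring

theorem quadForm_add {n : ℕ} (B C : Matrix (Fin n) (Fin n) ℝ) (v : EuclideanSpace ℝ (Fin n)) :
    quadForm (B + C) v = quadForm B v + quadForm C v := by
  simp [quadForm, Matrix.add_mulVec, dotProduct_add]

theorem quadForm_smul {n : ℕ} (c : ℝ) (B : Matrix (Fin n) (Fin n) ℝ)
    (v : EuclideanSpace ℝ (Fin n)) : quadForm (c • B) v = c * quadForm B v := by
  simp [quadForm, Matrix.smul_mulVec, dotProduct_smul]

theorem quadForm_sum {n : ℕ} {ι : Type*} (s : Finset ι) (B : ι → Matrix (Fin n) (Fin n) ℝ)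
    (v : EuclideanSpace ℝ (Fin n)) : quadForm (∑ i ∈ s, B i) v = ∑ i ∈ s, quadForm (B i) v := by
  simp [quadForm, Matrix.sum_mulVec, dotProduct_sum]

theorem quadForm_const_smul {n : ℕ} (B : Matrix (Fin n) (Fin n) ℝ) (c : ℝ)
    (v : EuclideanSpace ℝ (Fin n)) : quadForm B (c • v) = c ^ 2 * quadForm B v := by
  simp [quadForm, Matrix.mulVec_smul]; ring

/-- The bilinear form `(v, w) ↦ vᵀ B w`. -/
def matrixBilinForm {n : ℕ} (B : Matrix (Fin n) (Fin n) ℝ) :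
    LinearMap.BilinForm ℝ (EuclideanSpace ℝ (Fin n)) :=
  (Matrix.toLinearMap₂' ℝ B).compl₁₂ (WithLp.linearEquiv 2 ℝ (Fin n → ℝ)).toLinearMap
    (WithLp.linearEquiv 2 ℝ (Fin n → ℝ)).toLinearMap

theorem matrixBilinForm_apply_self {n : ℕ} (B : Matrix (Fin n) (Fin n) ℝ)
    (v : EuclideanSpace ℝ (Fin n)) : matrixBilinForm B v v = quadForm B v := by
  simp [matrixBilinForm, quadForm, Matrix.toLinearMap₂'_apply']

namespace NLP

variable {n p q : ℕ} {P : NLP n p q}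

theorem fderiv_lagrangian (hP : P.IsC2) (lam : Fin p → ℝ) (mu : Fin q → ℝ)
    (x : EuclideanSpace ℝ (Fin n)) :
    fderiv ℝ (P.lagrangian lam mu) x = fderiv ℝ P.f x + ∑ i, lam i • fderiv ℝ (P.g i) x
      + ∑ j, mu j • fderiv ℝ (P.h j) x := by
  have h2 : (2 : WithTop ℕ∞) ≠ 0 := by norm_num
  have hf := (hP.1.differentiable h2 x).hasFDerivAt
  have hg := HasFDerivAt.fun_sum (u := Finset.univ) fun i _ =>
    (((hP.2.1 i).differentiable h2 x).hasFDerivAt).const_mul (lam i)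
  have hh := HasFDerivAt.fun_sum (u := Finset.univ) fun j _ =>
    (((hP.2.2 j).differentiable h2 x).hasFDerivAt).const_mul (mu j)
  exact ((hf.add hg).add hh).fderiv

theorem lagrangianHessian_eq (hP : P.IsC2) (x : EuclideanSpace ℝ (Fin n))
    (m : (Fin p → ℝ) × (Fin q → ℝ)) :
    P.lagrangianHessian x m = hessianMatrix P.f x + ∑ i, m.1 i • hessianMatrix (P.g i) x
      + ∑ j, m.2 j • hessianMatrix (P.h j) x := by
  have hd : ∀ {F : EuclideanSpace ℝ (Fin n) → ℝ}, ContDiff ℝ 2 F →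
      HasFDerivAt (fderiv ℝ F) (fderiv ℝ (fderiv ℝ F) x) x := fun hF =>
    ((hF.fderiv_right (m := 1) (by norm_num)).differentiable (by norm_num) x).hasFDerivAt
  have hg := HasFDerivAt.fun_sum (u := Finset.univ) fun i _ => (hd (hP.2.1 i)).const_smul (m.1 i)
  have hh := HasFDerivAt.fun_sum (u := Finset.univ) fun j _ => (hd (hP.2.2 j)).const_smul (m.2 j)
  have hL : fderiv ℝ (fderiv ℝ (P.lagrangian m.1 m.2)) x = fderiv ℝ (fderiv ℝ P.f) x
      + ∑ i, m.1 i • fderiv ℝ (fderiv ℝ (P.g i)) x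
      + ∑ j, m.2 j • fderiv ℝ (fderiv ℝ (P.h j)) x := by
    rw [funext (fderiv_lagrangian hP m.1 m.2)]
    exact (((hd hP.1).add hg).add hh).fderiv
  ext i j
  simp [lagrangianHessian, hessianMatrix, hL, Matrix.sum_apply]

theorem mem_multiplierSet_iff (hP : P.IsC2) {x : EuclideanSpace ℝ (Fin n)}
    {m : (Fin p → ℝ) × (Fin q → ℝ)} :
    m ∈ P.multiplierSet x ↔ (fderiv ℝ P.f x + ∑ i, m.1 i • fderiv ℝ (P.g i) x
      + ∑ j, m.2 j • fderiv ℝ (P.h j) x = 0) ∧ (∀ i, 0 ≤ m.1 i) ∧ ∀ i, m.1 i * P.g i x = 0 := by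
  rw [multiplierSet, Set.mem_ofPred_eq, gradient_eq_zero_iff_fderiv_eq_zero, fderiv_lagrangian hP]

theorem MFCQ.linearIndependent_fderiv {x : EuclideanSpace ℝ (Fin n)} (h : P.MFCQ x) :
    LinearIndependent ℝ
      fun j => (fderiv ℝ (P.h j) x : EuclideanSpace ℝ (Fin n) →ₗ[ℝ] ℝ) := by
  refine Fintype.linearIndependent_iff.2 fun c hc => Fintype.linearIndependent_iff.1 h.1 c ?_
  refine ext_inner_right ℝ fun v => ?_
  have := congrArg (fun e => e v) hc
  simpa [sum_inner, inner_smul_left, inner_gradient_eq_fderiv] using this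

/-! ### The second-order necessary condition -/

open Filter Topology in
/-- Necessary condition in primal form: no direction `z` makes the second-order expansions along the
parabola `x + t v + (t² / 2) z` of the objective and of all relevant inequality constraints
negative, while those of the equality constraints vanish. -/
theorem not_exists_descent_parabola (hP : P.IsC2) {x : EuclideanSpace ℝ (Fin n)}
    (hx : P.IsLocalMinimizer x) (hM : P.MFCQ x) {v : EuclideanSpace ℝ (Fin n)}
    (hv : v ∈ P.criticalCone x) (z : EuclideanSpace ℝ (Fin n))
    (hf : fderiv ℝ P.f x z + fderiv ℝ (fderiv ℝ P.f) x v v < 0)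
    (hg : ∀ i ∈ P.activeSet x, fderiv ℝ (P.g i) x v = 0 →
      fderiv ℝ (P.g i) x z + fderiv ℝ (fderiv ℝ (P.g i)) x v v < 0)
    (hh : ∀ j, fderiv ℝ (P.h j) x z + fderiv ℝ (fderiv ℝ (P.h j)) x v v = 0) : False := by
  simp only [criticalCone, Set.mem_ofPred_eq, inner_gradient_eq_fderiv] at hv
  obtain ⟨ξ, hξ, hξh⟩ := exists_curve_of_zeros hP.2.2 hM.linearIndependent_fderiv hx.1.2 hv.2.2 hh
  have hξx : Tendsto ξ (𝓝[>] 0) (𝓝 x) := by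
    have hy : Continuous fun t : ℝ => x + t • v + (t ^ 2 / 2) • z := by fun_prop
    have h0 : Continuous fun t : ℝ => t ^ 2 := by fun_prop
    simpa using (hξ.trans_tendsto ((h0.tendsto' 0 0 (by simp)).mono_left nhdsWithin_le_nhds)).add
      ((hy.tendsto 0).mono_left nhdsWithin_le_nhds)
  have hgξ : ∀ i, ∀ᶠ t in 𝓝[>] 0, P.g i (ξ t) ≤ 0 := by
    intro i
    by_cases hi : P.g i x = 0
    · have := eventually_lt_along_curve (hP.2.1 i) hξ (hv.2.1 i hi) (hg i hi)
      exact this.mono fun t ht => ht.le.trans_eq hi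
    · have hlt := lt_of_le_of_ne (hx.1.1 i) hi
      have hc := ((hP.2.1 i).continuous.tendsto x).comp hξx
      exact (hc.eventually_lt_const hlt).mono fun t ht => ht.le
  have hfξ := eventually_lt_along_curve hP.1 hξ hv.1 fun _ => hf
  have hmin := hξx.eventually (eventually_nhdsWithin_iff.1 hx.2)
  obtain ⟨t, h1, h2, h3, h4⟩ :=
    (hξh.and ((eventually_all.2 hgξ).and (hfξ.and hmin))).exists
  exact (h4 ⟨h2, h1⟩).not_gt h3

/-- The second-order necessary condition under the Mangasarian–Fromovitz constraint qualification:
every critical direction has its own multiplier for which the Hessian of the Lagrangian is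
nonnegative in that direction. -/
theorem exists_multiplier_quadForm_nonneg (hP : P.IsC2) {x : EuclideanSpace ℝ (Fin n)}
    (hx : P.IsLocalMinimizer x) (hM : P.MFCQ x) {v : EuclideanSpace ℝ (Fin n)}
    (hv : v ∈ P.criticalCone x) :
    ∃ m ∈ P.multiplierSet x, 0 ≤ quadForm (P.lagrangianHessian x m) v := by
  classical
  let J : Set (Fin p) := {i | P.g i x = 0 ∧ fderiv ℝ (P.g i) x v = 0}
  obtain ⟨z₀, hz₀⟩ := exists_forall_apply_eq_of_linearIndependent hM.linearIndependent_fderiv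
    (fun j => -fderiv ℝ (fderiv ℝ (P.h j)) x v v)
  have hz₀ : ∀ j, fderiv ℝ (P.h j) x z₀ = -fderiv ℝ (fderiv ℝ (P.h j)) x v v := hz₀
  let φ : Option J → EuclideanSpace ℝ (Fin n) → ℝ := fun o => o.elim P.f fun i => P.g i
  obtain ⟨y, hy, hy0, hyb, hyspan⟩ := exists_multipliers_of_forall_exists_nonneg
    (fun o : Option J => (fderiv ℝ (φ o) x : EuclideanSpace ℝ (Fin n) →ₗ[ℝ] ℝ))
    (fun o => fderiv ℝ (φ o) x z₀ + fderiv ℝ (fderiv ℝ (φ o)) x v v)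
    (fun j => (fderiv ℝ (P.h j) x : EuclideanSpace ℝ (Fin n) →ₗ[ℝ] ℝ)) (by
      intro z hz
      have hz : ∀ j, fderiv ℝ (P.h j) x z = 0 := hz
      by_contra! hneg
      have hneg : ∀ o : Option J, fderiv ℝ (φ o) x z +
        (fderiv ℝ (φ o) x z₀ + fderiv ℝ (fderiv ℝ (φ o)) x v v) < 0 := hneg
      refine not_exists_descent_parabola hP hx hM hv (z + z₀) ?_ (fun i hi hiv => ?_) fun j => ?_
      · rw [map_add, add_assoc]; exact hneg none
      · rw [map_add, add_assoc]; exact hneg (some ⟨i, hi, hiv⟩)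
      · rw [map_add, hz, hz₀]; ring)
  obtain ⟨c, hc⟩ := (Submodule.mem_span_range_iff_exists_fun ℝ).1 hyspan
  have hc : ∀ w, ∑ j, c j * fderiv ℝ (P.h j) x w
      = y none * fderiv ℝ P.f x w + ∑ i : J, y (some i) * fderiv ℝ (P.g i) x w := by
    intro w
    have := congrArg (fun e => e w) hc
    simpa [Fintype.sum_option, φ] using this
  -- the constraint qualification makes the multiplier of the objective positive
  have hpos : 0 < y none := by
    refine lt_of_le_of_ne (hy none) fun h0 => hy0 ?_
    obtain ⟨u, hu, hu'⟩ := hM.2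
    simp only [inner_gradient_eq_fderiv] at hu hu'
    have hsum := hc u
    simp only [hu', mul_zero, Finset.sum_const_zero, ← h0, zero_mul, zero_add] at hsum
    have hterm := (Finset.sum_eq_zero_iff_of_nonpos (fun i _ =>
      mul_nonpos_of_nonneg_of_nonpos (hy (some i)) (hu i i.2.1).le)).1 hsum.symm
    funext o
    cases o with
    | none => exact h0.symm
    | some i =>
      exact (mul_eq_zero.1 (hterm i (Finset.mem_univ _))).resolve_right (hu i i.2.1).ne
  let lam : Fin p → ℝ := fun i => if h : i ∈ J then y (some ⟨i, h⟩) / y none else 0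
  have hlam : ∀ w : Fin p → ℝ, ∑ i : J, y (some i) * w i = y none * ∑ i, lam i * w i := by
    intro w
    rw [Finset.mul_sum]
    refine Fintype.sum_of_injective Subtype.val Subtype.val_injective _ _ (fun i hi => ?_)
      fun i => ?_
    · have : i ∉ J := by simpa using hi
      simp [lam, this]
    · simp only [lam, i.2, dif_pos, Subtype.coe_eta]
      field_simp
  have hmu : ∀ w : Fin q → ℝ, ∑ j, c j * w j = - (y none * ∑ j, (-c j / y none) * w j) := by
    intro w
    rw [Finset.mul_sum, ← Finset.sum_neg_distrib]
    refine Finset.sum_congr rfl fun j _ => ?_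
    field_simp
  refine ⟨(lam, fun j => -c j / y none), (mem_multiplierSet_iff hP).2 ⟨?_, fun i => ?_, fun i => ?_⟩,
    ?_⟩
  · ext w
    have h := hc w
    rw [hlam fun i => fderiv ℝ (P.g i) x w, hmu fun j => fderiv ℝ (P.h j) x w] at h
    simp only [_root_.add_apply, _root_.sum_apply,
      _root_.smul_apply, smul_eq_mul, _root_.zero_apply]
    refine (mul_eq_zero.1 ?_).resolve_left hpos.ne'
    linear_combination -h
  · by_cases hi : i ∈ J
    · simp only [lam, hi, dif_pos]; exact div_nonneg (hy _) hpos.le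
    · simp [lam, hi]
  · by_cases hi : i ∈ J
    · simp [hi.1]
    · simp [lam, hi]
  · rw [lagrangianHessian_eq hP]
    simp only [quadForm_add, quadForm_sum, quadForm_smul, quadForm_hessianMatrix]
    have h := hc z₀
    simp only [hz₀, mul_neg, Finset.sum_neg_distrib] at h
    rw [hmu fun j => fderiv ℝ (fderiv ℝ (P.h j)) x v v] at h
    simp only [Fintype.sum_option, φ, Option.elim_none, Option.elim_some, mul_add,
      Finset.sum_add_distrib] at hyb
    rw [hlam fun i => fderiv ℝ (fderiv ℝ (P.g i)) x v v] at hyb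
    refine (mul_nonneg_iff_of_pos_left hpos).1 ?_
    linarith

/-! ### The set of multipliers -/

theorem convex_multiplierSet (hP : P.IsC2) (x : EuclideanSpace ℝ (Fin n)) :
    Convex ℝ (P.multiplierSet x) := by
  intro m hm m' hm' a b ha hb hab
  rw [mem_multiplierSet_iff hP] at hm hm' ⊢
  refine ⟨?_, fun i => ?_, fun i => ?_⟩
  · ext w
    have h1 := congrArg (fun e => e w) hm.1
    have h2 := congrArg (fun e => e w) hm'.1
    simp only [_root_.add_apply, _root_.sum_apply,
      _root_.smul_apply, smul_eq_mul, _root_.zero_apply, Prod.fst_add,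
      Prod.snd_add, Prod.smul_fst, Prod.smul_snd, Pi.add_apply, Pi.smul_apply, add_mul,
      Finset.sum_add_distrib, mul_assoc, ← Finset.mul_sum] at h1 h2 ⊢
    linear_combination a * h1 + b * h2 - fderiv ℝ P.f x w * hab
  · exact add_nonneg (mul_nonneg ha (hm.2.1 i)) (mul_nonneg hb (hm'.2.1 i))
  · simp only [Prod.fst_add, Prod.smul_fst, Pi.add_apply, Pi.smul_apply, smul_eq_mul]
    linear_combination a * hm.2.2 i + b * hm'.2.2 i

/-- Under the constraint qualification the multipliers form a compact set: a direction `u` as in the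
qualification bounds the multipliers of the inequality constraints, and those determine the
multipliers of the equality constraints, continuously, by linear independence. -/
theorem isCompact_multiplierSet (hP : P.IsC2) {x : EuclideanSpace ℝ (Fin n)} (hM : P.MFCQ x) :
    IsCompact (P.multiplierSet x) := by
  classical
  obtain ⟨u, hu, hu'⟩ := hM.2
  simp only [inner_gradient_eq_fderiv] at hu hu'
  have hdual : ∀ j, ∃ z, ∀ k, fderiv ℝ (P.h k) x z = (Pi.single j 1 : Fin q → ℝ) k := fun j =>
    exists_forall_apply_eq_of_linearIndependent hM.linearIndependent_fderiv _
  choose z hz using hdual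
  let M : Fin p → ℝ := fun i => |fderiv ℝ P.f x u| / |fderiv ℝ (P.g i) x u|
  let N : (Fin p → ℝ) → (Fin p → ℝ) × (Fin q → ℝ) := fun l =>
    (l, fun j => -(fderiv ℝ P.f x (z j) + ∑ i, l i * fderiv ℝ (P.g i) x (z j)))
  have hN : Continuous N := by fun_prop
  refine ((isCompact_Icc (a := 0) (b := M)).image hN).of_isClosed_subset ?_ ?_
  · have : P.multiplierSet x = {m | fderiv ℝ P.f x + ∑ i, m.1 i • fderiv ℝ (P.g i) x
        + ∑ j, m.2 j • fderiv ℝ (P.h j) x = 0} ∩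
        ((⋂ i, {m | 0 ≤ m.1 i}) ∩ ⋂ i, {m | m.1 i * P.g i x = 0}) := by
      ext m; simp [mem_multiplierSet_iff hP]
    rw [this]
    refine (isClosed_eq (by fun_prop) continuous_const).inter (.inter ?_ ?_)
    · exact isClosed_iInter fun i => isClosed_le continuous_const (by fun_prop)
    · exact isClosed_iInter fun i => isClosed_eq (by fun_prop) continuous_const
  · intro m hm
    obtain ⟨h1, h2, h3⟩ := (mem_multiplierSet_iff hP).1 hm
    have h1 : ∀ w, fderiv ℝ P.f x w + ∑ i, m.1 i * fderiv ℝ (P.g i) x w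
        + ∑ j, m.2 j * fderiv ℝ (P.h j) x w = 0 := fun w => by
      simpa using congrArg (fun e => e w) h1
    refine ⟨m.1, ⟨h2, fun i => ?_⟩, Prod.ext rfl (funext fun j => ?_)⟩
    · by_cases hi : P.g i x = 0
      · have hneg := hu i hi
        rw [le_div_iff₀ (abs_pos.2 hneg.ne), abs_of_neg hneg]
        have hle : ∀ k, 0 ≤ m.1 k * -fderiv ℝ (P.g k) x u := by
          intro k
          by_cases hk : P.g k x = 0
          · exact mul_nonneg (h2 k) (neg_nonneg.2 (hu k hk).le)
          · simp [(mul_eq_zero.1 (h3 k)).resolve_right hk]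
        have hsum := Finset.single_le_sum (fun k _ => hle k) (Finset.mem_univ i)
        have := h1 u
        simp only [hu', mul_zero, Finset.sum_const_zero, add_zero] at this
        simp only [mul_neg, Finset.sum_neg_distrib] at hsum ⊢
        linarith [le_abs_self (fderiv ℝ P.f x u)]
      · rw [(mul_eq_zero.1 (h3 i)).resolve_right hi]
        positivity
    · have := h1 (z j)
      simp only [hz, Pi.single_apply, mul_ite, mul_one, mul_zero, Finset.sum_ite_eq',
        Finset.mem_univ, if_true] at this
      simp only [N]
      linarith

/-- By the Krein–Milman theorem, a linear subspace that contains the Hessians of the Lagrangian at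
the extreme multipliers contains them at all multipliers. -/
theorem lagrangianHessian_mem_of_extremePoints (hP : P.IsC2) {x : EuclideanSpace ℝ (Fin n)}
    (hM : P.MFCQ x) (V : Submodule ℝ (Matrix (Fin n) (Fin n) ℝ))
    (hV : ∀ m ∈ (P.multiplierSet x).extremePoints ℝ, P.lagrangianHessian x m ∈ V)
    {m : (Fin p → ℝ) × (Fin q → ℝ)} (hm : m ∈ P.multiplierSet x) :
    P.lagrangianHessian x m ∈ V := by
  rw [← closure_convexHull_extremePoints (isCompact_multiplierSet hP hM)
    (convex_multiplierSet hP x)] at hm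
  refine closure_minimal (t := {m | P.lagrangianHessian x m ∈ V}) (convexHull_min hV ?_) ?_ hm
  · intro m hm m' hm' a b _ _ hab
    have : P.lagrangianHessian x (a • m + b • m')
        = a • P.lagrangianHessian x m + b • P.lagrangianHessian x m' := by
      ext i j
      simp only [lagrangianHessian_eq hP, Prod.fst_add, Prod.snd_add, Prod.smul_fst, Prod.smul_snd,
        Pi.add_apply, Pi.smul_apply, Matrix.add_apply, Matrix.sum_apply, Matrix.smul_apply,
        smul_eq_mul, add_mul, Finset.sum_add_distrib, mul_assoc, ← Finset.mul_sum]
      linear_combination -(hessianMatrix P.f x i j) * hab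
    rw [Set.mem_ofPred_eq, this]
    exact V.add_mem (V.smul_mem _ hm) (V.smul_mem _ hm')
  · have hc : Continuous (P.lagrangianHessian x) := by
      rw [funext (lagrangianHessian_eq hP x)]
      fun_prop
    exact V.closed_of_finiteDimensional.preimage hc

end NLP

/-! ### One multiplier for all directions -/

theorem theorem6 {n p q : ℕ} (P : NLP n p q) (hP : P.IsC2)
    (x : EuclideanSpace ℝ (Fin n)) (hx : P.IsLocalMinimizer x) (hMFCQ : P.MFCQ x)
    (A : Fin 3 → Matrix (Fin n) (Fin n) ℝ) (hA : ∀ j, (A j).IsSymm)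
    (hgen : IsGeneratedBy
      (P.lagrangianHessian x '' (P.multiplierSet x).extremePoints ℝ) A)
    (hpos : ∃ s : Fin 3 → ℝ, (∑ j, s j • A j).PosDef)
    (K : Set (EuclideanSpace ℝ (Fin n))) (hK : IsRegularCone K)
    (hKC : K ⊆ P.criticalCone x) (hdim : 3 ≤ dimOf K) :
    ∃ m ∈ P.multiplierSet x, ∀ v ∈ K, 0 ≤ quadForm (P.lagrangianHessian x m) v := by
  obtain ⟨-, S, hS⟩ := hK
  obtain ⟨s, hs⟩ := hpos
  have hKS : K ⊆ S := hS ▸ Set.subset_union_left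
  have hSdim : 3 ≤ Module.finrank ℝ S :=
    hdim.trans (Submodule.finrank_mono (Submodule.span_le.2 hKS))
  have hE : ∀ a b : S, ∃ u, u ∉ Submodule.span ℝ {a, b} := by
    intro a b
    classical
    by_contra! h
    have htop : Submodule.span ℝ {a, b} = ⊤ := Submodule.eq_top_iff'.2 h
    have hcard := finrank_span_finset_le_card (R := ℝ) ({a, b} : Finset S)
    rw [Set.finrank, Finset.coe_pair, htop, finrank_top] at hcard
    have := Finset.card_le_two (a := a) (b := b)
    omega
  have hspan : ∀ m ∈ P.multiplierSet x, ∃ r : Fin 3 → ℝ,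
      P.lagrangianHessian x m = ∑ j, r j • A j := by
    intro m hm
    have := NLP.lagrangianHessian_mem_of_extremePoints hP hMFCQ
      (Submodule.span ℝ (Set.range A)) (fun m hm => by
        obtain ⟨r, hr⟩ := hgen _ ⟨m, hm, rfl⟩
        exact (Submodule.mem_span_range_iff_exists_fun ℝ).2 ⟨r, hr.symm⟩) hm
    obtain ⟨r, hr⟩ := (Submodule.mem_span_range_iff_exists_fun ℝ).1 this
    exact ⟨r, hr.symm⟩
  let Q : Fin 3 → LinearMap.BilinForm ℝ S := fun j =>
    (matrixBilinForm (A j)).compl₁₂ S.subtype S.subtype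
  have hQ : ∀ j (v : S), Q j v v = quadForm (A j) v := fun j v =>
    matrixBilinForm_apply_self (A j) v
  have hQpos : ∀ v : S, v ≠ 0 → 0 < ∑ j, s j * Q j v v := by
    intro v hv
    have h0 : (v : EuclideanSpace ℝ (Fin n)).ofLp ≠ 0 := by
      simpa using hv
    have := hs.dotProduct_mulVec_pos h0
    simp only [star_trivial] at this
    have h2 : 0 < quadForm (∑ j, s j • A j) (v : EuclideanSpace ℝ (Fin n)) := this
    simpa only [quadForm_sum, quadForm_smul, hQ] using h2
  obtain ⟨m, hm, hm'⟩ := exists_forall_nonneg_of_convexCone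
    (NLP.isCompact_multiplierSet hP hMFCQ) (NLP.convex_multiplierSet hP x)
    (fun (v : S) m => quadForm (P.lagrangianHessian x m) v) (fun v => by
      simp only [NLP.lagrangianHessian_eq hP, quadForm_add, quadForm_sum, quadForm_smul]
      fun_prop) (fun v m m' a b hab => by
      simp only [NLP.lagrangianHessian_eq hP, quadForm_add, quadForm_sum, quadForm_smul,
        Prod.fst_add, Prod.snd_add, Prod.smul_fst, Prod.smul_snd, Pi.add_apply, Pi.smul_apply,
        smul_eq_mul, add_mul, Finset.sum_add_distrib, mul_assoc, ← Finset.mul_sum]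
      linear_combination -(quadForm (hessianMatrix P.f x) v) * hab) (fun v w => by
      obtain ⟨l, hl⟩ := exists_forall_apply_self_eq_add hE Q s hQpos v w
      refine ⟨l, fun m hm => ?_⟩
      obtain ⟨r, hr⟩ := hspan m hm
      simp only [hQ] at hl
      simp only [hr, quadForm_sum, quadForm_smul, hl, mul_add, Finset.sum_add_distrib])
    (fun v c hc => ⟨√c • v, fun m _ => by
      rw [Submodule.coe_smul, quadForm_const_smul, Real.sq_sqrt hc]⟩) (fun v => by
      -- quadratic forms are even, so a direction in `-K` may be replaced by its negative
      have hv : (v : EuclideanSpace ℝ (Fin n)) ∈ K ∪ {x | -x ∈ K} := hS ▸ v.2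
      rcases hv with hv | hv
      · exact NLP.exists_multiplier_quadForm_nonneg hP hx hMFCQ (hKC hv)
      · obtain ⟨m, hm, h⟩ := NLP.exists_multiplier_quadForm_nonneg hP hx hMFCQ (hKC hv)
        refine ⟨m, hm, ?_⟩
        rw [← neg_one_smul ℝ, quadForm_const_smul] at h
        simpa using h)
  exact ⟨m, hm, fun v hv => hm' ⟨v, hKS hv⟩⟩
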